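/- For $n\ge 1$ let $\|x\|_1=\sum_{i=1}^n|x_i|$ on $\mathbb R^n$ and $B_1^n=\{x\in\mathbb R^n:\|x\|_1\le 1\}$. Let $\gamma_1^n$ be the measure on $\mathbb R^n$ with Lebesgue density $2^{-n}e^{-\|x\|_1}$, and let $\lambda_{B_1^n}$ be the uniform probability measure on $B_1^n$ (normalized restriction of Lebesgue measure), regarded as a measure on $\mathbb R^n$. For a Borel probability measure $\nu$ on $\mathbb R^n$ with the $\ell_1$ metric, the concentration function is $$\alpha_\nu(\varepsilon)=\sup\{1-\nu(A_\varepsilon): A\subset\mathbb R^n\text{ Borel},\ \nu(A)\ge 1/2\},\qquad A_\varepsilon=\{x:\|x-a\|_1\le\varepsilon\text{ for some }a\in A\};$$ write $\alpha_{(B_1^n,\lambda_{B_1^n})}$ for $\alpha_\nu$ with $\nu=\lambda_{B_1^n}$. There are universal constants $a,b,c,K>0$ such that for every $n\ge1$: 1. there is a nondecreasing function $u:[0,\infty)\to[0,\infty)$ with $u(0)=0$ such that the radial map $Ux=\frac{u(\|x\|_1)}{\|x\|_1}x$ (with $U0=0$) is Borel and pushes $\gamma_1^n$ forward to $\lambda_{B_1^n}$,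 and whose (least) Lipschitz constant satisfies $\frac an\le\|u\|_{Lip}\le\frac bn$; 2. for every $\varepsilon>0$, $\ \alpha_{(B_1^n,\lambda_{B_1^n})}(\varepsilon)\le K e^{-c\varepsilon^2 n}$. -/

import Mathlib

open MeasureTheory Set
open scoped NNReal ENNReal

noncomputable section

/-- The closed `ε`-expansion `{x | d(x, a) ≤ ε for some a ∈ A}` of a set `A`. -/
def expansion {X : Type*} [PseudoMetricSpace X] (ε : ℝ) (A : Set X) : Set X :=
  {x | ∃ a ∈ A, dist x a ≤ ε}

/-- The concentration function
`α(ε) = sup {1 - μ(A_ε) : A measurable, μ(A) ≥ 1/2}` of a metric probability space. -/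
def concentrationFunction {X : Type*} [PseudoMetricSpace X] [MeasurableSpace X]
    (μ : Measure X) (ε : ℝ) : ℝ≥0∞ :=
  ⨆ (A : Set X) (_ : MeasurableSet A) (_ : 1 / 2 ≤ μ A), (1 - μ (expansion ε A))

/-- `ℝⁿ` with the norm `‖x‖₁ = ∑ i, |x i|` and the metric induced by it. -/
abbrev EllOne (n : ℕ) : Type := PiLp 1 (fun _ : Fin n => ℝ)

/-- Lebesgue measure on `ℝⁿ`, carried over to `EllOne n` by the identity map. -/
def lebesgueEllOne (n : ℕ) : Measure (EllOne n) :=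
  (volume : Measure (Fin n → ℝ)).map (WithLp.toLp 1)

/-- The exponential measure, with Lebesgue density `2⁻ⁿ exp (-‖x‖₁)`. -/
def expMeasure (n : ℕ) : Measure (EllOne n) :=
  (lebesgueEllOne n).withDensity
    (fun x => ENNReal.ofReal ((2 : ℝ)⁻¹ ^ n * Real.exp (-‖x‖)))

/-- The cross-polytope, i.e. the closed unit ball of the `ℓ₁` norm. -/
def crossPolytope (n : ℕ) : Set (EllOne n) := Metric.closedBall 0 1

/-- The uniform probability measure on the cross-polytope: normalized restriction of
Lebesgue measure, seen as a measure on `ℝⁿ`. -/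
def uniformCrossPolytope (n : ℕ) : Measure (EllOne n) :=
  ((lebesgueEllOne n) (crossPolytope n))⁻¹ • (lebesgueEllOne n).restrict (crossPolytope n)

/-- The radial map `x ↦ (u(‖x‖) / ‖x‖) x` (with value `0` at the origin). -/
def radialMap {n : ℕ} (u : ℝ≥0 → ℝ≥0) (x : EllOne n) : EllOne n :=
  ((u ‖x‖₊ : ℝ) / ‖x‖) • x

end

/-!
Let `F` be the distribution function of `‖x‖` under `expMeasure n`. Since the norm of a uniform
point of the cross-polytope has distribution function `s ^ n`, the radial map with profile
`F ^ (1 / n)` transports `expMeasure n` to the uniform measure. The slope of this profile is largest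
at the origin, where it equals `(n !) ^ (-1 / n)`, a quantity between `1 / n` and `e / n`; the
radial map itself is then Lipschitz with constant `2 e / n`.

For concentration, a bound on `∫ exp f * ∫ exp (-f)` over all Lipschitz functions `f` passes to
product measures and to Lipschitz images. For the two-sided exponential law on the line and
`l`-Lipschitz functions, `f s = l * s` is extremal and the bound is `(1 - l ^ 2)⁻¹ ^ 2`, so
`expMeasure n` satisfies the bound `exp (4 * l ^ 2 * n)` for `l ^ 2 ≤ 1 / 2`. The map to the
cross-polytope multiplies the exponent `l * ε` of the Markov bound by a factor of order `n`, and
`l` can be chosen proportional to `ε` because the diameter of the cross-polytope is `2`.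
-/

open Real (exp)

section LaplaceBound

variable {X Y : Type*} [MeasurableSpace X] [MeasurableSpace Y] {μ : Measure X} {ν : Measure Y}
  {d : X → X → ℝ} {e : Y → Y → ℝ} {C D : ℝ≥0∞}

/-- `C` bounds the Laplace transform of the symmetrization `f x - f x'` of every function `f` that
is `1`-Lipschitz for the cost `d`, where `x` and `x'` are independent of law `μ`. The double
integral over `μ.prod μ` is written as a product of two single ones. -/
def HasLaplaceBound (d : X → X → ℝ) (μ : Measure X) (C : ℝ≥0∞) : Prop :=
  ∀ f : X → ℝ, Measurable f → (∀ x y, f x - f y ≤ d x y) →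
    (∫⁻ x, ENNReal.ofReal (exp (f x)) ∂μ) * ∫⁻ x, ENNReal.ofReal (exp (-f x)) ∂μ ≤ C

theorem lintegral_ofReal_exp_ne_zero [NeZero μ] {f : X → ℝ} (hf : Measurable f) :
    ∫⁻ x, ENNReal.ofReal (exp (f x)) ∂μ ≠ 0 := by
  rw [Ne, lintegral_eq_zero_iff (by fun_prop)]
  intro h
  obtain ⟨x, hx⟩ := h.exists
  exact (ENNReal.ofReal_pos.2 (Real.exp_pos (f x))).ne' hx

theorem log_lintegral_exp_sub_le [NeZero μ] {f g : X → ℝ} (hf : Measurable f) (hg : Measurable g)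
    {t : ℝ} (hfg : ∀ x, f x - g x ≤ t) (hg_top : ∫⁻ x, ENNReal.ofReal (exp (g x)) ∂μ ≠ ∞) :
    Real.log (∫⁻ x, ENNReal.ofReal (exp (f x)) ∂μ).toReal -
      Real.log (∫⁻ x, ENNReal.ofReal (exp (g x)) ∂μ).toReal ≤ t := by
  have hle : ∫⁻ x, ENNReal.ofReal (exp (f x)) ∂μ ≤
      ENNReal.ofReal (exp t) * ∫⁻ x, ENNReal.ofReal (exp (g x)) ∂μ := by
    rw [← lintegral_const_mul _ (by fun_prop)]
    refine lintegral_mono fun x => ?_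
    rw [← ENNReal.ofReal_mul (by positivity), ← Real.exp_add]
    gcongr
    linarith [hfg x]
  have htop := ENNReal.mul_ne_top (ENNReal.ofReal_ne_top (r := exp t)) hg_top
  have hf_pos := ENNReal.toReal_pos (lintegral_ofReal_exp_ne_zero hf) (ne_top_of_le_ne_top htop hle)
  have hg_pos := ENNReal.toReal_pos (lintegral_ofReal_exp_ne_zero hg) hg_top
  rw [sub_le_iff_le_add, Real.log_le_iff_le_exp hf_pos, Real.exp_add, Real.exp_log hg_pos,
    ← ENNReal.toReal_ofReal (Real.exp_pos t).le, ← ENNReal.toReal_mul]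
  exact ENNReal.toReal_mono htop hle

theorem lintegral_exp_mul_lintegral_exp_neg [SFinite μ] {f : X → ℝ} (hf : Measurable f) :
    (∫⁻ x, ENNReal.ofReal (exp (f x)) ∂μ) * ∫⁻ x, ENNReal.ofReal (exp (-f x)) ∂μ =
      ∫⁻ p, ENNReal.ofReal (Real.cosh (f p.1 - f p.2)) ∂μ.prod μ := by
  have hdouble : 2 * ∫⁻ p, ENNReal.ofReal (Real.cosh (f p.1 - f p.2)) ∂μ.prod μ =
      (∫⁻ p, ENNReal.ofReal (exp (f p.1)) * ENNReal.ofReal (exp (-f p.2)) ∂μ.prod μ) +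
        ∫⁻ p, ENNReal.ofReal (exp (-f p.1)) * ENNReal.ofReal (exp (f p.2)) ∂μ.prod μ := by
    rw [← lintegral_const_mul _ (by fun_prop), ← lintegral_add_left (by fun_prop)]
    refine lintegral_congr fun p => ?_
    rw [← ENNReal.ofReal_mul (by positivity), ← ENNReal.ofReal_mul (by positivity),
      ← ENNReal.ofReal_add (by positivity) (by positivity), ← ENNReal.ofReal_ofNat,
      ← ENNReal.ofReal_mul zero_le_two, ← Real.exp_add, ← Real.exp_add, Real.cosh_eq]
    congr 1
    ring_nf
  rw [lintegral_prod_mul (f := fun x => ENNReal.ofReal (exp (f x)))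
      (g := fun x => ENNReal.ofReal (exp (-f x))) (by fun_prop) (by fun_prop),
    lintegral_prod_mul (f := fun x => ENNReal.ofReal (exp (-f x)))
      (g := fun x => ENNReal.ofReal (exp (f x))) (by fun_prop) (by fun_prop),
    mul_comm (∫⁻ x, ENNReal.ofReal (exp (-f x)) ∂μ), ← two_mul] at hdouble
  exact ((ENNReal.mul_right_inj two_ne_zero ENNReal.ofNat_ne_top).1 hdouble).symm

theorem hasLaplaceBound_abs_sub [SFinite μ] {g : X → ℝ} (hg : Measurable g) :
    HasLaplaceBound (fun x y => |g x - g y|) μ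
      ((∫⁻ x, ENNReal.ofReal (exp (g x)) ∂μ) * ∫⁻ x, ENNReal.ofReal (exp (-g x)) ∂μ) := by
  intro f hf hfg
  rw [lintegral_exp_mul_lintegral_exp_neg hf, lintegral_exp_mul_lintegral_exp_neg hg]
  refine lintegral_mono fun p => ENNReal.ofReal_le_ofReal (Real.cosh_le_cosh.2 ?_)
  refine abs_le'.2 ⟨hfg p.1 p.2, ?_⟩
  rw [neg_sub, abs_sub_comm]
  exact hfg p.2 p.1

namespace HasLaplaceBound

theorem map (h : HasLaplaceBound d μ C) {T : X → Y} (hT : Measurable T)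
    (hed : ∀ x x', e (T x) (T x') ≤ d x x') : HasLaplaceBound e (μ.map T) C := by
  intro f hf hfe
  rw [lintegral_map (by fun_prop) hT, lintegral_map (by fun_prop) hT]
  exact h (f ∘ T) (hf.comp hT) fun x x' => (hfe _ _).trans (hed x x')

theorem lintegral_exp_ne_top [NeZero μ] (h : HasLaplaceBound d μ C) (hC : C ≠ ∞) {f : X → ℝ}
    (hf : Measurable f) (hfd : ∀ x y, f x - f y ≤ d x y) :
    ∫⁻ x, ENNReal.ofReal (exp (f x)) ∂μ ≠ ∞ := by
  intro htop
  have hle := h f hf hfd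
  rw [htop, ENNReal.top_mul (lintegral_ofReal_exp_ne_zero hf.fun_neg), top_le_iff] at hle
  exact hC hle

theorem prod [SFinite μ] [SFinite ν] (hμ : HasLaplaceBound d μ C) (hν : HasLaplaceBound e ν D)
    (hd : ∀ x, d x x = 0) (he : ∀ y, e y y = 0) (hC : C ≠ ∞) :
    HasLaplaceBound (fun p q : X × Y => d p.1 q.1 + e p.2 q.2) (μ.prod ν) (C * D) := by
  rcases eq_zero_or_neZero μ with rfl | _
  · simp [HasLaplaceBound]
  intro f hf hfde
  have hf_slice (y : Y) : Measurable fun x => f (x, y) := by fun_prop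
  have hfd (y : Y) (x x' : X) : f (x, y) - f (x', y) ≤ d x x' := by
    simpa [he] using hfde (x, y) (x', y)
  have hfe (y y' : Y) (x : X) : f (x, y) - f (x, y') ≤ e y y' := by
    simpa [hd] using hfde (x, y) (x, y')
  set g : Y → ℝ≥0∞ := fun y => ∫⁻ x, ENNReal.ofReal (exp (f (x, y))) ∂μ
  have hg : Measurable g :=
    Measurable.lintegral_prod_left' (f := fun p => ENNReal.ofReal (exp (f p))) (by fun_prop)
  have hg_zero (y : Y) : g y ≠ 0 := lintegral_ofReal_exp_ne_zero (hf_slice y)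
  have hg_top (y : Y) : g y ≠ ∞ := hμ.lintegral_exp_ne_top hC (hf_slice y) (hfd y)
  have hg_toReal (y : Y) : 0 < (g y).toReal := ENNReal.toReal_pos (hg_zero y) (hg_top y)
  -- Integrating out `x`, the logarithm of `g` is `1`-Lipschitz for `e`.
  have hlog := hν (fun y => Real.log (g y).toReal) (by fun_prop) fun y y' =>
    log_lintegral_exp_sub_le (hf_slice y) (hf_slice y') (hfe y y') (hg_top y')
  simp only [Real.exp_neg, Real.exp_log (hg_toReal _), ENNReal.ofReal_inv_of_pos (hg_toReal _),
    ENNReal.ofReal_toReal (hg_top _)] at hlog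
  calc (∫⁻ p, ENNReal.ofReal (exp (f p)) ∂μ.prod ν) *
        ∫⁻ p, ENNReal.ofReal (exp (-f p)) ∂μ.prod ν
      = (∫⁻ y, g y ∂ν) * ∫⁻ y, ∫⁻ x, ENNReal.ofReal (exp (-f (x, y))) ∂μ ∂ν := by
        rw [lintegral_prod_symm' _ (by fun_prop), lintegral_prod_symm' _ (by fun_prop)]
    _ ≤ (∫⁻ y, g y ∂ν) * ∫⁻ y, C * (g y)⁻¹ ∂ν := by
        gcongr with y
        rw [← div_eq_mul_inv, ENNReal.le_div_iff_mul_le (.inl (hg_zero y)) (.inl (hg_top y)),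
          mul_comm]
        exact hμ _ (hf_slice y) (hfd y)
    _ = C * ((∫⁻ y, g y ∂ν) * ∫⁻ y, (g y)⁻¹ ∂ν) := by
        rw [lintegral_const_mul' _ _ hC, mul_left_comm]
    _ ≤ C * D := by gcongr

theorem pi {n : ℕ} {X : Fin n → Type*} [∀ i, MeasurableSpace (X i)] {d : ∀ i, X i → X i → ℝ}
    {μ : ∀ i, Measure (X i)} [∀ i, SigmaFinite (μ i)] {C : Fin n → ℝ≥0∞}
    (h : ∀ i, HasLaplaceBound (d i) (μ i) (C i)) (hd : ∀ i x, d i x x = 0) (hC : ∀ i, C i ≠ ∞) :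
    HasLaplaceBound (fun x y => ∑ i, d i (x i) (y i)) (Measure.pi μ) (∏ i, C i) := by
  induction n with
  | zero =>
    intro f _ _
    rw [Measure.pi_of_empty μ (x := finZeroElim), lintegral_dirac, lintegral_dirac]
    simp [← ENNReal.ofReal_mul (Real.exp_pos _).le, ← Real.exp_add]
  | succ n ih =>
    rw [← (measurePreserving_piFinSuccAbove μ 0).symm.map_eq, Fin.prod_univ_succ]
    have htail := ih (fun i => h i.succ) (fun i => hd i.succ) fun i => hC i.succ
    refine ((h 0).prod htail (hd 0) (fun x => by simp [hd]) (hC 0)).map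
      (MeasurableEquiv.measurable _) fun p q => ?_
    rw [Fin.sum_univ_succ]
    exact le_rfl

end HasLaplaceBound

end LaplaceBound

section Concentration

theorem compl_expansion_subset_le_infDist {X : Type*} [PseudoMetricSpace X] {ε : ℝ} {A : Set X}
    (hA : A.Nonempty) : (expansion ε A)ᶜ ⊆ {x | ε ≤ Metric.infDist x A} :=
  fun _ hx => (Metric.le_infDist hA).2 fun {a} ha => le_of_not_ge fun h => hx ⟨a, ha, h⟩

variable {X : Type*} [PseudoMetricSpace X] [MeasurableSpace X] {μ : Measure X}

theorem HasLaplaceBound.measure_mul_measure_le_infDist_le [OpensMeasurableSpace X] {l : ℝ}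
    {C : ℝ≥0∞} (h : HasLaplaceBound (fun x y => l * dist x y) μ C) (hl : 0 ≤ l) (A : Set X)
    (t : ℝ) :
    μ A * μ {x | t ≤ Metric.infDist x A} ≤ C * ENNReal.ofReal (exp (-(l * t))) := by
  set f : X → ℝ := fun x => l * Metric.infDist x A
  have hf : Measurable f := measurable_infDist.const_mul l
  have hLip (x y : X) : f x - f y ≤ l * dist x y := by
    rw [← mul_sub]
    gcongr
    linarith [Metric.infDist_le_infDist_add_dist (s := A) (x := x) (y := y)]
  have hA : μ A ≤ ∫⁻ x, ENNReal.ofReal (exp (-f x)) ∂μ :=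
    calc μ A ≤ μ {x | 1 ≤ ENNReal.ofReal (exp (-f x))} :=
          measure_mono fun x hx => by simp [f, Metric.infDist_zero_of_mem hx]
      _ ≤ ∫⁻ x, ENNReal.ofReal (exp (-f x)) ∂μ := by
          simpa using mul_meas_ge_le_lintegral (μ := μ)
            (f := fun x => ENNReal.ofReal (exp (-f x))) (by fun_prop) 1
  have hfar : μ {x | t ≤ Metric.infDist x A} ≤
      (∫⁻ x, ENNReal.ofReal (exp (f x)) ∂μ) / ENNReal.ofReal (exp (l * t)) :=
    calc μ {x | t ≤ Metric.infDist x A}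
        ≤ μ {x | ENNReal.ofReal (exp (l * t)) ≤ ENNReal.ofReal (exp (f x))} :=
          measure_mono fun x hx => ENNReal.ofReal_le_ofReal <|
            Real.exp_le_exp.2 (mul_le_mul_of_nonneg_left hx hl)
      _ ≤ _ := meas_ge_le_lintegral_div (by fun_prop)
          (ENNReal.ofReal_pos.2 (Real.exp_pos _)).ne' ENNReal.ofReal_ne_top
  calc μ A * μ {x | t ≤ Metric.infDist x A}
      ≤ (∫⁻ x, ENNReal.ofReal (exp (-f x)) ∂μ) *
          ((∫⁻ x, ENNReal.ofReal (exp (f x)) ∂μ) / ENNReal.ofReal (exp (l * t))) := by gcongr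
    _ = (∫⁻ x, ENNReal.ofReal (exp (f x)) ∂μ) * (∫⁻ x, ENNReal.ofReal (exp (-f x)) ∂μ) *
          ENNReal.ofReal (exp (-(l * t))) := by
        rw [Real.exp_neg (l * t), ENNReal.ofReal_inv_of_pos (Real.exp_pos _), div_eq_mul_inv]
        ring
    _ ≤ C * ENNReal.ofReal (exp (-(l * t))) := by gcongr; exact h f hf hLip

theorem concentrationFunction_le_of_hasLaplaceBound [OpensMeasurableSpace X]
    [IsProbabilityMeasure μ] {l : ℝ} {C : ℝ≥0∞}
    (h : HasLaplaceBound (fun x y => l * dist x y) μ C) (hl : 0 ≤ l) (ε : ℝ) :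
    concentrationFunction μ ε ≤ 2 * (C * ENNReal.ofReal (exp (-(l * ε)))) := by
  refine iSup₂_le fun A _ => iSup_le fun hA => ?_
  have hne : A.Nonempty := nonempty_of_measure_ne_zero (ne_bot_of_le_ne_bot (by simp) hA)
  calc 1 - μ (expansion ε A) ≤ μ (expansion ε A)ᶜ := by
        rw [tsub_le_iff_left, ← measure_univ (μ := μ)]
        exact measure_univ_le_add_compl _
    _ ≤ μ {x | ε ≤ Metric.infDist x A} := measure_mono (compl_expansion_subset_le_infDist hne)
    _ = 2 * (1 / 2 * μ {x | ε ≤ Metric.infDist x A}) := by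
        rw [← mul_assoc, ENNReal.mul_div_cancel two_ne_zero ENNReal.ofNat_ne_top, one_mul]
    _ ≤ 2 * (μ A * μ {x | ε ≤ Metric.infDist x A}) := by gcongr
    _ ≤ 2 * (C * ENNReal.ofReal (exp (-(l * ε)))) := by
        exact mul_le_mul_right (h.measure_mul_measure_le_infDist_le hl A ε) 2

theorem concentrationFunction_eq_zero_of_dist_le [IsProbabilityMeasure μ] {s : Set X} {ε : ℝ}
    (hs : ∀ᵐ x ∂μ, x ∈ s) (hε : ∀ x ∈ s, ∀ y ∈ s, dist x y ≤ ε) :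
    concentrationFunction μ ε = 0 := by
  refine nonpos_iff_eq_zero.1 <| iSup₂_le fun A _ => iSup_le fun hA => ?_
  have hne : μ (s ∩ A) ≠ 0 := by
    rw [Measure.measure_inter_eq_of_ae hs]
    exact ne_bot_of_le_ne_bot (by simp) hA
  obtain ⟨a, has, haA⟩ := nonempty_of_measure_ne_zero hne
  have hfull : expansion ε A =ᵐ[μ] univ :=
    Filter.eventuallyEq_univ.2 <| hs.mono fun x hx => ⟨a, haA, hε x hx a has⟩
  rw [measure_congr hfull, measure_univ, tsub_self]

end Concentration

section Laplace

theorem lintegral_Iic_exp_mul {a : ℝ} (ha : 0 < a) :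
    ∫⁻ s in Iic (0 : ℝ), ENNReal.ofReal (exp (a * s)) = ENNReal.ofReal a⁻¹ := by
  rw [← ofReal_integral_eq_lintegral_ofReal (integrableOn_exp_mul_Iic ha 0)
    (.of_forall fun s => (Real.exp_pos _).le), integral_exp_mul_Iic ha]
  simp

theorem lintegral_Ioi_exp_mul {a : ℝ} (ha : a < 0) :
    ∫⁻ s in Ioi (0 : ℝ), ENNReal.ofReal (exp (a * s)) = ENNReal.ofReal (-a)⁻¹ := by
  rw [← ofReal_integral_eq_lintegral_ofReal (integrableOn_exp_mul_Ioi ha 0)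
    (.of_forall fun s => (Real.exp_pos _).le), integral_exp_mul_Ioi ha]
  simp [neg_div, inv_neg]

/-- The two-sided exponential (Laplace) distribution on the real line. -/
noncomputable def laplaceMeasure : Measure ℝ :=
  volume.withDensity fun s => ENNReal.ofReal (2⁻¹ * exp (-|s|))

theorem lintegral_exp_mul_laplaceMeasure {l : ℝ} (hl : |l| < 1) :
    ∫⁻ s, ENNReal.ofReal (exp (l * s)) ∂laplaceMeasure = ENNReal.ofReal (1 - l ^ 2)⁻¹ := by
  obtain ⟨hneg, hpos⟩ := abs_lt.1 hl
  have hleft : ∫⁻ s in Iic (0 : ℝ), ENNReal.ofReal (exp (l * s - |s|)) =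
      ENNReal.ofReal (l + 1)⁻¹ := by
    rw [← lintegral_Iic_exp_mul (by linarith)]
    refine setLIntegral_congr_fun measurableSet_Iic fun s hs => ?_
    simp only [abs_of_nonpos (mem_Iic.1 hs), add_mul, one_mul, sub_neg_eq_add]
  have hright : ∫⁻ s in Ioi (0 : ℝ), ENNReal.ofReal (exp (l * s - |s|)) =
      ENNReal.ofReal (1 - l)⁻¹ := by
    rw [← neg_sub, ← lintegral_Ioi_exp_mul (by linarith)]
    refine setLIntegral_congr_fun measurableSet_Ioi fun s hs => ?_
    simp only [abs_of_pos (mem_Ioi.1 hs), sub_mul, one_mul]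
  calc ∫⁻ s, ENNReal.ofReal (exp (l * s)) ∂laplaceMeasure
      = ∫⁻ s, ENNReal.ofReal 2⁻¹ * ENNReal.ofReal (exp (l * s - |s|)) := by
        rw [laplaceMeasure, lintegral_withDensity_eq_lintegral_mul _ (by fun_prop) (by fun_prop)]
        refine lintegral_congr fun s => ?_
        rw [Pi.mul_apply, ← ENNReal.ofReal_mul (by positivity),
          ← ENNReal.ofReal_mul (by positivity), mul_assoc, ← Real.exp_add, neg_add_eq_sub]
    _ = ENNReal.ofReal 2⁻¹ * (ENNReal.ofReal (l + 1)⁻¹ + ENNReal.ofReal (1 - l)⁻¹) := by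
        rw [lintegral_const_mul _ (by fun_prop), ← lintegral_add_compl _ measurableSet_Iic,
          compl_Iic, hleft, hright]
    _ = ENNReal.ofReal (1 - l ^ 2)⁻¹ := by
        have : 0 < l + 1 := by linarith
        have : 0 < 1 - l := by linarith
        rw [← ENNReal.ofReal_add (by positivity) (by positivity),
          ← ENNReal.ofReal_mul (by positivity), show 1 - l ^ 2 = (l + 1) * (1 - l) by ring]
        congr 1
        field_simp
        ring

instance : IsProbabilityMeasure laplaceMeasure where
  measure_univ := by simpa using lintegral_exp_mul_laplaceMeasure (l := 0) (by simp)

theorem hasLaplaceBound_laplaceMeasure {l : ℝ} (hl₀ : 0 ≤ l) (hl₁ : l < 1) :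
    HasLaplaceBound (fun s t => l * |s - t|) laplaceMeasure (ENNReal.ofReal (1 - l ^ 2)⁻¹ ^ 2) := by
  have hl : |l| < 1 := by rwa [abs_of_nonneg hl₀]
  have h := hasLaplaceBound_abs_sub (μ := laplaceMeasure) (g := fun s => l * s) (by fun_prop)
  simp only [← mul_sub, abs_mul, abs_of_nonneg hl₀, ← neg_mul] at h
  rwa [lintegral_exp_mul_laplaceMeasure hl, lintegral_exp_mul_laplaceMeasure (by rwa [abs_neg]),
    neg_sq, ← sq] at h

end Laplace

section Pi

theorem lintegral_prod_eval_pi {n : ℕ} {X : Fin n → Type*} [∀ i, MeasurableSpace (X i)]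
    (μ : ∀ i, Measure (X i)) [∀ i, SigmaFinite (μ i)] {f : ∀ i, X i → ℝ≥0∞}
    (hf : ∀ i, Measurable (f i)) :
    ∫⁻ x, ∏ i, f i (x i) ∂Measure.pi μ = ∏ i, ∫⁻ s, f i s ∂μ i := by
  induction n with
  | zero => simp
  | succ n ih =>
    have htail : Measurable fun x : ∀ i : Fin n, X i.succ => ∏ i, f i.succ (x i) :=
      Finset.measurable_prod _ fun i _ => (hf i.succ).comp (measurable_pi_apply i)
    rw [← (measurePreserving_piFinSuccAbove μ 0).symm.lintegral_comp_emb
      (MeasurableEquiv.measurableEmbedding _), Fin.prod_univ_succ, ← ih _ fun i => hf i.succ,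
      ← lintegral_prod_mul (hf 0).aemeasurable htail.aemeasurable]
    refine lintegral_congr fun p => ?_
    rw [Fin.prod_univ_succ]
    rfl

theorem pi_withDensity {n : ℕ} {X : Fin n → Type*} [∀ i, MeasurableSpace (X i)]
    (μ : ∀ i, Measure (X i)) [∀ i, SigmaFinite (μ i)] {w : ∀ i, X i → ℝ≥0∞}
    (hw : ∀ i, Measurable (w i)) [∀ i, SigmaFinite ((μ i).withDensity (w i))] :
    Measure.pi (fun i => (μ i).withDensity (w i)) =
      (Measure.pi μ).withDensity fun x => ∏ i, w i (x i) := by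
  refine Measure.pi_eq fun s hs => ?_
  rw [withDensity_apply _ (MeasurableSet.univ_pi hs), Measure.restrict_pi_pi,
    lintegral_prod_eval_pi _ hw]
  exact Finset.prod_congr rfl fun i _ => (withDensity_apply _ (hs i)).symm

end Pi

section ExpMeasure

variable {n : ℕ}

theorem measurable_toLp_one : Measurable (WithLp.toLp 1 : (Fin n → ℝ) → EllOne n) :=
  (PiLp.continuous_toLp 1 _).measurable

theorem ellOne_dist_eq (x y : EllOne n) : dist x y = ∑ i, |x i - y i| := by
  simp [dist_eq_norm, PiLp.norm_eq_of_nat 1]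

theorem prod_laplaceDensity (x : Fin n → ℝ) :
    ∏ i, ENNReal.ofReal (2⁻¹ * exp (-|x i|)) =
      ENNReal.ofReal ((2 : ℝ)⁻¹ ^ n * exp (-‖(WithLp.toLp 1 x : EllOne n)‖)) := by
  rw [← ENNReal.ofReal_prod_of_nonneg fun i _ => by positivity, Finset.prod_mul_distrib,
    ← Real.exp_sum, PiLp.norm_eq_of_nat 1 (by simp)]
  simp

theorem map_toLp_pi_laplaceMeasure :
    (Measure.pi fun _ : Fin n => laplaceMeasure).map (WithLp.toLp 1) = expMeasure n := by
  have : SigmaFinite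
      ((volume : Measure ℝ).withDensity fun s => ENNReal.ofReal (2⁻¹ * exp (-|s|))) :=
    inferInstanceAs (SigmaFinite laplaceMeasure)
  have hpi : (Measure.pi fun _ : Fin n => laplaceMeasure) =
      volume.withDensity fun x => ∏ i, ENNReal.ofReal (2⁻¹ * exp (-|x i|)) :=
    pi_withDensity _ fun _ => by fun_prop
  ext s hs
  rw [Measure.map_apply measurable_toLp_one hs, hpi, expMeasure, lebesgueEllOne,
    withDensity_apply _ hs, withDensity_apply _ (measurable_toLp_one hs),
    setLIntegral_map hs (by fun_prop) measurable_toLp_one]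
  simp only [prod_laplaceDensity]

instance : IsProbabilityMeasure (expMeasure n) := by
  rw [← map_toLp_pi_laplaceMeasure]
  exact Measure.isProbabilityMeasure_map measurable_toLp_one.aemeasurable

theorem hasLaplaceBound_expMeasure {l : ℝ} (hl₀ : 0 ≤ l) (hl₁ : l < 1) :
    HasLaplaceBound (fun x y => l * dist x y) (expMeasure n)
      ((ENNReal.ofReal (1 - l ^ 2)⁻¹ ^ 2) ^ n) := by
  have h := HasLaplaceBound.pi (fun _ : Fin n => hasLaplaceBound_laplaceMeasure hl₀ hl₁)
    (fun _ s => by simp) fun _ => by finiteness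
  rw [Finset.prod_const, Finset.card_univ, Fintype.card_fin] at h
  rw [← map_toLp_pi_laplaceMeasure]
  exact h.map measurable_toLp_one fun x y => by rw [ellOne_dist_eq, Finset.mul_sum]

end ExpMeasure

section RadialProfile

open Filter Topology
open scoped Nat

/-- The density of the Gamma distribution of shape `m + 1` and rate `1`, which is the law of `‖x‖`
under a measure proportional to `exp (-‖x‖)` on a normed space of dimension `m + 1`. -/
noncomputable def erlangDensity (m : ℕ) (r : ℝ) : ℝ := r ^ m * exp (-r) / m !

/-- The distribution function of the law with density `erlangDensity m` on `[0, ∞)`. -/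
noncomputable def erlangCDF (m : ℕ) (r : ℝ) : ℝ := ∫ t in (0 : ℝ)..r, erlangDensity m t

/-- The Lipschitz constant of `radialProfile m`. -/
noncomputable def radialLip (m : ℕ) : ℝ := ((m + 1)! : ℝ)⁻¹ ^ (m + 1 : ℝ)⁻¹

/-- The increasing map of `(0, ∞)` onto `(0, 1)` that transports `erlangDensity m` to the density
`(m + 1) * s ^ m` of the norm of a uniform point in the unit ball of a space of dimension
`m + 1`. -/
noncomputable def radialProfile (m : ℕ) (r : ℝ) : ℝ := erlangCDF m r ^ (m + 1 : ℝ)⁻¹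

variable (m : ℕ) {r s : ℝ}

theorem continuous_erlangDensity : Continuous (erlangDensity m) := by
  unfold erlangDensity
  fun_prop

theorem erlangDensity_pos (hr : 0 < r) : 0 < erlangDensity m r := by
  unfold erlangDensity
  positivity

theorem hasDerivAt_erlangCDF (r : ℝ) : HasDerivAt (erlangCDF m) (erlangDensity m r) r :=
  ((continuous_erlangDensity m).integral_hasStrictDerivAt 0 r).hasDerivAt

theorem continuous_erlangCDF : Continuous (erlangCDF m) :=
  continuous_iff_continuousAt.2 fun r => (hasDerivAt_erlangCDF m r).continuousAt

theorem erlangCDF_zero : erlangCDF m 0 = 0 := intervalIntegral.integral_same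

theorem strictMonoOn_erlangCDF : StrictMonoOn (erlangCDF m) (Ici 0) := by
  refine strictMonoOn_of_deriv_pos (convex_Ici 0) (continuous_erlangCDF m).continuousOn
    fun r hr => ?_
  rw [interior_Ici] at hr
  rw [(hasDerivAt_erlangCDF m r).deriv]
  exact erlangDensity_pos m hr

theorem erlangCDF_pos (hr : 0 < r) : 0 < erlangCDF m r :=
  (erlangCDF_zero m).symm.trans_lt (strictMonoOn_erlangCDF m self_mem_Ici hr.le hr)

theorem erlangCDF_nonneg (hr : 0 ≤ r) : 0 ≤ erlangCDF m r :=
  (erlangCDF_zero m).symm.trans_le ((strictMonoOn_erlangCDF m).monotoneOn self_mem_Ici hr hr)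

theorem erlangDensity_eq_Gamma_integrand :
    erlangDensity m = fun r => exp (-r) * r ^ ((m + 1 : ℝ) - 1) / m ! := by
  ext r
  rw [add_sub_cancel_right, Real.rpow_natCast, erlangDensity, mul_comm]

theorem tendsto_erlangCDF : Tendsto (erlangCDF m) atTop (𝓝 1) := by
  have hint : IntegrableOn (erlangDensity m) (Ioi 0) := by
    rw [erlangDensity_eq_Gamma_integrand]
    exact (Real.GammaIntegral_convergent (by positivity)).div_const _
  have hone : ∫ r in Ioi 0, erlangDensity m r = 1 := by
    simp only [erlangDensity_eq_Gamma_integrand]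
    rw [integral_div, ← Real.Gamma_eq_integral (by positivity), Real.Gamma_nat_eq_factorial,
      div_self (by positivity)]
  rw [← hone]
  exact intervalIntegral_tendsto_integral_Ioi 0 hint tendsto_id

theorem erlangCDF_lt_one (hr : 0 ≤ r) : erlangCDF m r < 1 := by
  have hr₁ : 0 ≤ r + 1 := by positivity
  have hlim : erlangCDF m (r + 1) ≤ 1 := by
    refine ge_of_tendsto (tendsto_erlangCDF m) ?_
    filter_upwards [eventually_ge_atTop (r + 1)] with s hs
    exact (strictMonoOn_erlangCDF m).monotoneOn hr₁ (hr₁.trans hs) hs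
  exact (strictMonoOn_erlangCDF m hr hr₁ (lt_add_one r)).trans_le hlim

theorem le_erlangCDF (hr : 0 ≤ r) : r ^ (m + 1) * exp (-r) / (m + 1)! ≤ erlangCDF m r := by
  calc r ^ (m + 1) * exp (-r) / (m + 1)!
      = ∫ t in (0 : ℝ)..r, t ^ m * (exp (-r) / m !) := by
        rw [intervalIntegral.integral_mul_const, integral_pow, Nat.factorial_succ]
        push_cast
        field_simp
        simp
    _ ≤ erlangCDF m r := by
        refine intervalIntegral.integral_mono_on hr
          (Continuous.intervalIntegrable (by fun_prop) _ _)
          ((continuous_erlangDensity m).intervalIntegrable _ _) fun t ⟨ht₀, htr⟩ => ?_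
        rw [erlangDensity, mul_div_assoc]
        gcongr

theorem radialLip_pos : 0 < radialLip m := by
  unfold radialLip
  positivity

theorem radialLip_pow : radialLip m ^ (m + 1) = ((m + 1)! : ℝ)⁻¹ := by
  rw [radialLip, ← Nat.cast_succ]
  exact Real.rpow_inv_natCast_pow (by positivity) m.succ_ne_zero

theorem one_div_le_radialLip : 1 / (m + 1) ≤ radialLip m := by
  refine le_of_pow_le_pow_left₀ m.succ_ne_zero (radialLip_pos m).le ?_
  rw [radialLip_pow, div_pow, one_pow, one_div]
  gcongr
  exact_mod_cast Nat.factorial_le_pow (m + 1)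

theorem radialLip_le : radialLip m ≤ exp 1 / (m + 1) := by
  refine le_of_pow_le_pow_left₀ m.succ_ne_zero (by positivity) ?_
  have h := Real.pow_div_factorial_le_exp (x := m + 1) (by positivity) (m + 1)
  rw [radialLip_pow, div_pow, ← Real.exp_nat_mul, mul_one, le_div_iff₀ (by positivity),
    ← div_eq_inv_mul]
  exact_mod_cast h

theorem continuous_radialProfile : Continuous (radialProfile m) :=
  (continuous_erlangCDF m).rpow_const fun _ => .inr (by positivity)

theorem radialProfile_zero : radialProfile m 0 = 0 := by
  rw [radialProfile, erlangCDF_zero, Real.zero_rpow (by positivity)]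

theorem radialProfile_pos (hr : 0 < r) : 0 < radialProfile m r :=
  Real.rpow_pos_of_pos (erlangCDF_pos m hr) _

theorem radialProfile_nonneg (hr : 0 ≤ r) : 0 ≤ radialProfile m r :=
  Real.rpow_nonneg (erlangCDF_nonneg m hr) _

theorem radialProfile_lt_one (hr : 0 ≤ r) : radialProfile m r < 1 :=
  Real.rpow_lt_one (erlangCDF_nonneg m hr) (erlangCDF_lt_one m hr) (by positivity)

theorem radialProfile_pow (hr : 0 ≤ r) : radialProfile m r ^ (m + 1) = erlangCDF m r := by
  rw [radialProfile, ← Nat.cast_succ]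
  exact Real.rpow_inv_natCast_pow (erlangCDF_nonneg m hr) m.succ_ne_zero

theorem strictMonoOn_radialProfile : StrictMonoOn (radialProfile m) (Ici 0) :=
  fun _ hr _ hs hrs => Real.rpow_lt_rpow (erlangCDF_nonneg m hr)
    (strictMonoOn_erlangCDF m hr hs hrs) (by positivity)

theorem image_radialProfile : radialProfile m '' Ioi 0 = Ioo 0 1 := by
  refine Subset.antisymm ?_ fun s ⟨hs₀, hs₁⟩ => ?_
  · rintro _ ⟨r, hr, rfl⟩
    exact ⟨radialProfile_pos m hr, radialProfile_lt_one m (le_of_lt hr)⟩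
  have hlim : Tendsto (radialProfile m) atTop (𝓝 1) := by
    have h := (tendsto_erlangCDF m).rpow_const (p := (m + 1 : ℝ)⁻¹) (.inl one_ne_zero)
    rwa [Real.one_rpow] at h
  obtain ⟨R, hsR, hR⟩ := ((hlim.eventually_const_lt hs₁).and (eventually_ge_atTop 0)).exists
  obtain ⟨r, ⟨hr, -⟩, rfl⟩ := intermediate_value_Icc hR (continuous_radialProfile m).continuousOn
    ⟨(radialProfile_zero m).trans_le hs₀.le, hsR.le⟩
  refine ⟨r, lt_of_le_of_ne hr ?_, rfl⟩
  rintro rfl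
  exact hs₀.ne' (radialProfile_zero m)

theorem le_radialProfile (hr : 0 ≤ r) :
    r * exp (-r / (m + 1)) * radialLip m ≤ radialProfile m r := by
  refine le_of_pow_le_pow_left₀ m.succ_ne_zero (radialProfile_nonneg m hr) ?_
  rw [radialProfile_pow m hr, mul_pow, mul_pow, radialLip_pow, ← Real.exp_nat_mul, Nat.cast_succ,
    mul_div_cancel₀ _ (by positivity), ← div_eq_mul_inv]
  exact le_erlangCDF m hr

theorem hasDerivAt_radialProfile (hr : 0 < r) :
    HasDerivAt (radialProfile m) (erlangDensity m r / ((m + 1) * radialProfile m r ^ m)) r := by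
  have hF := (erlangCDF_pos m hr).ne'
  have hv := (radialProfile_pos m hr).ne'
  refine ((hasDerivAt_erlangCDF m r).rpow_const (p := (m + 1 : ℝ)⁻¹) (.inl hF)).congr_deriv ?_
  rw [Real.rpow_sub_one hF, ← radialProfile, ← radialProfile_pow m hr.le]
  field_simp
  ring

theorem erlangDensity_le (hr : 0 ≤ r) :
    erlangDensity m r ≤
      radialLip m * ((m + 1) * (r * exp (-r / (m + 1)) * radialLip m) ^ m) := by
  have hL := radialLip_pos m
  have hfact : (m ! : ℝ)⁻¹ = (m + 1) * radialLip m ^ (m + 1) := by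
    rw [radialLip_pow, Nat.factorial_succ]
    push_cast
    field_simp
  have hexp : exp (-r) ≤ exp (-r / (m + 1)) ^ m := by
    rw [← Real.exp_nat_mul, Real.exp_le_exp, mul_div_assoc', le_div_iff₀ (by positivity)]
    linarith
  calc erlangDensity m r = r ^ m * exp (-r) * ((m + 1) * radialLip m ^ (m + 1)) := by
        rw [erlangDensity, div_eq_mul_inv, hfact]
    _ ≤ r ^ m * exp (-r / (m + 1)) ^ m * ((m + 1) * radialLip m ^ (m + 1)) := by gcongr
    _ = radialLip m * ((m + 1) * (r * exp (-r / (m + 1)) * radialLip m) ^ m) := by ring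

theorem deriv_radialProfile_le (hr : 0 < r) : deriv (radialProfile m) r ≤ radialLip m := by
  have hv := radialProfile_pos m hr
  have hL := radialLip_pos m
  rw [(hasDerivAt_radialProfile m hr).deriv, div_le_iff₀ (by positivity)]
  refine (erlangDensity_le m hr.le).trans ?_
  gcongr
  exact le_radialProfile m hr.le

theorem radialProfile_sub_le (hr : 0 ≤ r) (hrs : r ≤ s) :
    radialProfile m s - radialProfile m r ≤ radialLip m * (s - r) := by
  refine (convex_Ici (0 : ℝ)).image_sub_le_mul_sub_of_deriv_le
    (continuous_radialProfile m).continuousOn (fun t ht => ?_) (fun t ht => ?_)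
    r hr s (hr.trans hrs) hrs <;> rw [interior_Ici] at ht
  · exact (hasDerivAt_radialProfile m ht).differentiableAt.differentiableWithinAt
  · exact deriv_radialProfile_le m ht

theorem lintegral_comp_radialProfile (g : ℝ → ℝ≥0∞) :
    ∫⁻ r in Ioi 0, ENNReal.ofReal (erlangDensity m r) * g (radialProfile m r) =
      ∫⁻ s in Ioo 0 1, ENNReal.ofReal ((m + 1) * s ^ m) * g s := by
  rw [← image_radialProfile m, lintegral_image_eq_lintegral_abs_deriv_mul measurableSet_Ioi
    (fun r hr => (hasDerivAt_radialProfile m hr).hasDerivWithinAt)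
    ((strictMonoOn_radialProfile m).injOn.mono Ioi_subset_Ici_self)]
  refine setLIntegral_congr_fun measurableSet_Ioi fun r hr => ?_
  have hv := radialProfile_pos m hr
  have hd := erlangDensity_pos m hr
  rw [← mul_assoc, ← ENNReal.ofReal_mul (abs_nonneg _), abs_of_nonneg (by positivity),
    div_mul_cancel₀ _ (by positivity)]

theorem lintegral_pow_mul_exp_neg_mul_comp_radialProfile (g : ℝ → ℝ≥0∞) :
    ∫⁻ r in Ioi 0, ENNReal.ofReal (r ^ m * exp (-r)) * g (radialProfile m r) =
      (m + 1)! * ∫⁻ s in Ioo 0 1, ENNReal.ofReal (s ^ m) * g s := by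
  have hdens (r : ℝ) : ENNReal.ofReal (r ^ m * exp (-r)) =
      m ! * ENNReal.ofReal (erlangDensity m r) := by
    rw [← ENNReal.ofReal_natCast, ← ENNReal.ofReal_mul (by positivity), erlangDensity,
      mul_div_cancel₀ _ (by positivity)]
  have hpow (s : ℝ) : ENNReal.ofReal ((m + 1) * s ^ m) = (m + 1 : ℕ) * ENNReal.ofReal (s ^ m) := by
    rw [← ENNReal.ofReal_natCast, ← ENNReal.ofReal_mul (by positivity), Nat.cast_succ]
  simp only [hdens, mul_assoc]
  rw [lintegral_const_mul' _ _ (ENNReal.natCast_ne_top _), lintegral_comp_radialProfile]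
  simp only [hpow, mul_assoc]
  rw [lintegral_const_mul' _ _ (ENNReal.natCast_ne_top _), Nat.factorial_succ, Nat.cast_mul,
    ← mul_assoc, mul_comm (m ! : ℝ≥0∞)]

/-- The restriction of `radialProfile m` to `[0, ∞)`, in the form taken by `radialMap`. -/
noncomputable def transportProfile (r : ℝ≥0) : ℝ≥0 :=
  ⟨radialProfile m r, radialProfile_nonneg m r.2⟩

theorem transportProfile_zero : transportProfile m 0 = 0 := NNReal.eq (radialProfile_zero m)

theorem monotone_transportProfile : Monotone (transportProfile m) := fun r s h =>
  (strictMonoOn_radialProfile m).monotoneOn r.2 s.2 h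

theorem lipschitzWith_transportProfile :
    LipschitzWith (radialLip m).toNNReal (transportProfile m) := by
  have h : LipschitzWith (radialLip m).toNNReal fun r => (transportProfile m r : ℝ) := by
    refine .of_le_add_mul _ fun r s => ?_
    rw [Real.coe_toNNReal _ (radialLip_pos m).le]
    rcases le_total r s with hrs | hsr
    · have := NNReal.coe_le_coe.2 (monotone_transportProfile m hrs)
      have := radialLip_pos m
      linarith [show 0 ≤ radialLip m * dist r s by positivity]
    · rw [NNReal.dist_eq, abs_of_nonneg (sub_nonneg.2 (NNReal.coe_le_coe.2 hsr)),
        ← sub_le_iff_le_add']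
      exact radialProfile_sub_le m s.2 hsr
  exact fun r s => h r s

/-- The Lipschitz constant is attained at the origin, by `le_radialProfile`. -/
theorem radialLip_le_of_lipschitzWith {M : ℝ≥0} (hM : LipschitzWith M (transportProfile m)) :
    radialLip m ≤ M := by
  have hquot (r : ℝ) (hr : 0 < r) : exp (-r / (m + 1)) * radialLip m ≤ M := by
    have h : |radialProfile m r - (transportProfile m 0 : ℝ)| ≤ M * |r - 0| :=
      hM.dist_le_mul ⟨r, hr.le⟩ 0
    rw [transportProfile_zero, NNReal.coe_zero, sub_zero, sub_zero, abs_of_pos hr,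
      abs_of_pos (radialProfile_pos m hr)] at h
    refine le_of_mul_le_mul_left ?_ hr
    linarith [le_radialProfile m hr.le]
  have hlim : Tendsto (fun r : ℝ => exp (-r / (m + 1)) * radialLip m) (𝓝[>] 0)
      (𝓝 (radialLip m)) := by
    have hcont : Continuous fun r : ℝ => exp (-r / (m + 1)) * radialLip m := by fun_prop
    simpa using (hcont.tendsto 0).mono_left nhdsWithin_le_nhds
  exact le_of_tendsto hlim (eventually_mem_nhdsWithin.mono hquot)

end RadialProfile

section RadialTransport

open Metric
open scoped Nat

variable {E : Type*} [NormedAddCommGroup E] [NormedSpace ℝ E] {u : ℝ≥0 → ℝ≥0}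

/-- The radial map `x ↦ (u ‖x‖ / ‖x‖) • x` of a normed space, with value `0` at the origin. On
`EllOne n` it is definitionally equal to `radialMap u`. -/
noncomputable def radialRescaling (u : ℝ≥0 → ℝ≥0) (x : E) : E := ((u ‖x‖₊ : ℝ) / ‖x‖) • x

theorem radialRescaling_smul (u : ℝ≥0 → ℝ≥0) {r : ℝ≥0} (hr : 0 < r) {θ : E} (hθ : ‖θ‖ = 1) :
    radialRescaling u (r • θ) = u r • θ := by
  have hnorm : ‖r • θ‖₊ = r := by
    ext
    simp [NNReal.smul_def, norm_smul, hθ]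
  rw [radialRescaling, ← coe_nnnorm, hnorm, NNReal.smul_def, NNReal.smul_def, smul_smul,
    div_mul_cancel₀ _ (NNReal.coe_pos.2 hr).ne']

theorem measurable_radialRescaling [MeasurableSpace E] [BorelSpace E] [SecondCountableTopology E]
    (hu : Measurable u) : Measurable (radialRescaling u : E → E) := by
  unfold radialRescaling
  fun_prop

theorem abs_div_sub_div_mul_le {M : ℝ≥0} (hmono : Monotone u) (hu : LipschitzWith M u)
    (hu₀ : u 0 = 0) {r s : ℝ≥0} (hsr : s ≤ r) :
    |(u r / r - u s / s : ℝ)| * s ≤ M * (r - s) := by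
  have hcancel (t : ℝ≥0) : (u t / t : ℝ) * t = u t :=
    div_mul_cancel_of_imp fun ht => by simp [NNReal.coe_eq_zero.1 ht, hu₀]
  have hsplit : (u r / r - u s / s : ℝ) * s = (u r - u s) - u r / r * (r - s) := by
    linear_combination hcancel r - hcancel s
  have hrs : (0 : ℝ) ≤ r - s := sub_nonneg.2 hsr
  have hsub₀ : (0 : ℝ) ≤ u r - u s := sub_nonneg.2 (hmono hsr)
  have hsub : (u r - u s : ℝ) ≤ M * (r - s) := by
    simpa only [NNReal.dist_eq, abs_of_nonneg hsub₀, abs_of_nonneg hrs] using hu.dist_le_mul r s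
  have hslope : (u r / r : ℝ) ≤ M :=
    div_le_of_le_mul₀ r.2 M.2 (by simpa [hu₀, NNReal.dist_eq] using hu.dist_le_mul r 0)
  rw [← NNReal.abs_eq s, ← abs_mul, NNReal.abs_eq, hsplit]
  exact abs_sub_le_of_nonneg_of_le hsub₀ hsub (by positivity) (by gcongr)

theorem lipschitzWith_radialRescaling {M : ℝ≥0} (hmono : Monotone u) (hu : LipschitzWith M u)
    (hu₀ : u 0 = 0) : LipschitzWith (2 * M) (radialRescaling u : E → E) := by
  refine LipschitzWith.of_dist_le_mul fun x y => ?_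
  wlog hyx : ‖y‖₊ ≤ ‖x‖₊ generalizing x y
  · rw [dist_comm, dist_comm x]
    exact this y x (le_of_not_ge hyx)
  have hslope : (u ‖x‖₊ : ℝ) / ‖x‖ ≤ M :=
    div_le_of_le_mul₀ (norm_nonneg _) M.2
      (by simpa [hu₀, NNReal.dist_eq] using hu.dist_le_mul ‖x‖₊ 0)
  have hradial : |(u ‖x‖₊ : ℝ) / ‖x‖ - u ‖y‖₊ / ‖y‖| * ‖y‖ ≤ M * ‖x - y‖ :=
    (abs_div_sub_div_mul_le hmono hu hu₀ hyx).trans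
      (mul_le_mul_of_nonneg_left (norm_sub_norm_le x y) M.2)
  calc dist (radialRescaling u x) (radialRescaling u y)
      = ‖((u ‖x‖₊ : ℝ) / ‖x‖) • (x - y) + ((u ‖x‖₊ : ℝ) / ‖x‖ - u ‖y‖₊ / ‖y‖) • y‖ := by
        rw [dist_eq_norm, radialRescaling, radialRescaling]
        congr 1
        module
    _ ≤ (u ‖x‖₊ : ℝ) / ‖x‖ * ‖x - y‖ + |(u ‖x‖₊ : ℝ) / ‖x‖ - u ‖y‖₊ / ‖y‖| * ‖y‖ := by
        refine (norm_add_le _ _).trans_eq ?_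
        rw [norm_smul, norm_smul, Real.norm_of_nonneg (by positivity), Real.norm_eq_abs]
    _ ≤ M * ‖x - y‖ + M * ‖x - y‖ := by gcongr
    _ = (2 * M : ℝ≥0) * dist x y := by
        rw [dist_eq_norm, NNReal.coe_mul, NNReal.coe_ofNat]
        ring

variable [MeasurableSpace E] [BorelSpace E] [FiniteDimensional ℝ E] (μ : Measure E)
  [μ.IsAddHaarMeasure]

theorem lintegral_eq_lintegral_toSphere [Nontrivial E] {f : E → ℝ≥0∞} (hf : Measurable f) :
    ∫⁻ x, f x ∂μ = ∫⁻ θ, ∫⁻ r in Ioi (0 : ℝ),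
      ENNReal.ofReal (r ^ (Module.finrank ℝ E - 1)) * f (r • (θ : E)) ∂volume ∂μ.toSphere := by
  calc ∫⁻ x, f x ∂μ = ∫⁻ x : ({0}ᶜ : Set E), f x ∂μ.comap (↑) := by
        rw [lintegral_subtype_comap (measurableSet_singleton _).compl, restrict_compl_singleton]
    _ = ∫⁻ p, f ((p.2 : ℝ) • (p.1 : E))
          ∂μ.toSphere.prod (.volumeIoiPow (Module.finrank ℝ E - 1)) := by
        rw [← μ.measurePreserving_homeomorphUnitSphereProd.lintegral_comp_emb
          (Homeomorph.measurableEmbedding _)]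
        refine lintegral_congr fun x => ?_
        rw [← homeomorphUnitSphereProd_symm_apply_coe, Homeomorph.symm_apply_apply]
    _ = ∫⁻ θ, ∫⁻ r, f ((r : ℝ) • (θ : E)) ∂.volumeIoiPow (Module.finrank ℝ E - 1)
          ∂μ.toSphere := lintegral_prod _ (by fun_prop)
    _ = _ := by
        refine lintegral_congr fun θ => ?_
        rw [Measure.volumeIoiPow, lintegral_withDensity_eq_lintegral_mul _ (by fun_prop)
          (by fun_prop)]
        exact lintegral_subtype_comap measurableSet_Ioi
          fun r : ℝ => ENNReal.ofReal (r ^ (Module.finrank ℝ E - 1)) * f (r • (θ : E))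

theorem setLIntegral_closedBall_eq_lintegral_toSphere [Nontrivial E] {f : E → ℝ≥0∞}
    (hf : Measurable f) :
    ∫⁻ x in closedBall 0 1, f x ∂μ = ∫⁻ θ, ∫⁻ r in Ioo (0 : ℝ) 1,
      ENNReal.ofReal (r ^ (Module.finrank ℝ E - 1)) * f (r • (θ : E)) ∂volume ∂μ.toSphere := by
  rw [← lintegral_indicator measurableSet_closedBall,
    lintegral_eq_lintegral_toSphere μ (hf.indicator measurableSet_closedBall)]
  refine lintegral_congr fun θ => ?_
  rw [Measure.restrict_congr_set Ioo_ae_eq_Ioc, ← Ioi_inter_Iic, inter_comm,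
    ← Measure.restrict_restrict measurableSet_Iic, ← lintegral_indicator measurableSet_Iic]
  refine setLIntegral_congr_fun measurableSet_Ioi fun r hr => ?_
  have hmem : r • (θ : E) ∈ closedBall 0 1 ↔ r ∈ Iic 1 := by
    rw [mem_closedBall_zero_iff, norm_smul, norm_eq_of_mem_sphere, mul_one,
      Real.norm_of_nonneg (le_of_lt hr), mem_Iic]
  simp only [indicator, hmem, mul_ite, mul_zero]

theorem map_radialRescaling_withDensity_exp_neg_norm {m : ℕ} (hE : Module.finrank ℝ E = m + 1) :
    (μ.withDensity fun x => ENNReal.ofReal (exp (-‖x‖))).map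
        (radialRescaling (transportProfile m)) =
      ((m + 1)! : ℝ≥0∞) • μ.restrict (closedBall 0 1) := by
  have : Nontrivial E := Module.nontrivial_of_finrank_pos (R := ℝ) (hE ▸ m.succ_pos)
  have hU : Measurable (radialRescaling (transportProfile m) : E → E) :=
    measurable_radialRescaling (lipschitzWith_transportProfile m).continuous.measurable
  refine Measure.ext_of_lintegral _ fun f hf => ?_
  have hfU : Measurable fun x => f (radialRescaling (transportProfile m) x) := hf.comp hU
  rw [lintegral_map hf hU, lintegral_withDensity_eq_lintegral_mul _ (by fun_prop) hfU,
    lintegral_smul_measure, smul_eq_mul, setLIntegral_closedBall_eq_lintegral_toSphere μ hf,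
    lintegral_eq_lintegral_toSphere μ (by fun_prop),
    ← lintegral_const_mul' _ _ (ENNReal.natCast_ne_top _), hE, Nat.add_sub_cancel]
  refine lintegral_congr fun θ => ?_
  rw [← lintegral_pow_mul_exp_neg_mul_comp_radialProfile m fun s => f (s • (θ : E))]
  refine setLIntegral_congr_fun measurableSet_Ioi fun r (hr : 0 < r) => ?_
  have hθ : ‖(θ : E)‖ = 1 := norm_eq_of_mem_sphere θ
  have hU_smul : radialRescaling (transportProfile m) (r • (θ : E)) = radialProfile m r • (θ : E) :=
    radialRescaling_smul _ (r := ⟨r, hr.le⟩) hr hθ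
  rw [Pi.mul_apply, hU_smul, norm_smul, hθ, mul_one, Real.norm_of_nonneg hr.le, ← mul_assoc,
    ENNReal.ofReal_mul (by positivity)]

end RadialTransport

section CrossPolytope

open scoped Nat

instance (n : ℕ) : (lebesgueEllOne n).IsAddHaarMeasure :=
  (PiLp.continuousLinearEquiv 1 ℝ fun _ : Fin n => ℝ).symm.isAddHaarMeasure_map volume

theorem finrank_ellOne (n : ℕ) : Module.finrank ℝ (EllOne n) = n := by
  rw [(WithLp.linearEquiv 1 ℝ (Fin n → ℝ)).finrank_eq, Module.finrank_fin_fun]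

theorem measure_crossPolytope_pos (n : ℕ) : 0 < lebesgueEllOne n (crossPolytope n) :=
  Metric.measure_closedBall_pos _ _ one_pos

theorem measure_crossPolytope_lt_top (n : ℕ) : lebesgueEllOne n (crossPolytope n) < ∞ :=
  measure_closedBall_lt_top

instance (n : ℕ) : IsProbabilityMeasure (uniformCrossPolytope n) where
  measure_univ := by
    rw [uniformCrossPolytope, Measure.smul_apply, Measure.restrict_apply_univ, smul_eq_mul,
      ENNReal.inv_mul_cancel (measure_crossPolytope_pos n).ne' (measure_crossPolytope_lt_top n).ne]

theorem ae_mem_crossPolytope (n : ℕ) : ∀ᵐ x ∂uniformCrossPolytope n, x ∈ crossPolytope n :=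
  Measure.ae_smul_measure (ae_restrict_mem Metric.isClosed_closedBall.measurableSet) _

theorem dist_le_two_of_mem_crossPolytope {n : ℕ} {x y : EllOne n} (hx : x ∈ crossPolytope n)
    (hy : y ∈ crossPolytope n) : dist x y ≤ 2 := by
  linarith [dist_triangle_right x y 0, Metric.mem_closedBall.1 hx, Metric.mem_closedBall.1 hy]

theorem eq_inv_smul_restrict_of_eq_smul_restrict {X : Type*} [MeasurableSpace X] {μ ν : Measure X}
    [IsProbabilityMeasure ν] {s : Set X} {c : ℝ≥0∞} (hν : ν = c • μ.restrict s) :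
    ν = (μ s)⁻¹ • μ.restrict s := by
  have hc : c * μ s = 1 := by
    rw [← smul_eq_mul, ← Measure.restrict_apply_univ, ← Measure.smul_apply, ← hν, measure_univ]
  rwa [← ENNReal.eq_inv_of_mul_eq_one_left hc]

theorem expMeasure_eq_smul (n : ℕ) :
    expMeasure n = ENNReal.ofReal (2⁻¹ ^ n) •
      (lebesgueEllOne n).withDensity fun x => ENNReal.ofReal (exp (-‖x‖)) := by
  rw [← withDensity_smul _ (by fun_prop), expMeasure]
  congr 1 with x
  rw [Pi.smul_apply, smul_eq_mul, ENNReal.ofReal_mul (by positivity)]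

variable (m : ℕ)

theorem measurable_radialMap_transportProfile :
    Measurable (radialMap (n := m + 1) (transportProfile m)) :=
  measurable_radialRescaling (lipschitzWith_transportProfile m).continuous.measurable

theorem map_radialMap_transportProfile :
    (expMeasure (m + 1)).map (radialMap (transportProfile m)) = uniformCrossPolytope (m + 1) := by
  have : IsProbabilityMeasure ((expMeasure (m + 1)).map (radialMap (transportProfile m))) :=
    Measure.isProbabilityMeasure_map (measurable_radialMap_transportProfile m).aemeasurable
  have hmap : ((lebesgueEllOne (m + 1)).withDensity fun x => ENNReal.ofReal (exp (-‖x‖))).map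
      (radialMap (transportProfile m)) =
        ((m + 1)! : ℝ≥0∞) • (lebesgueEllOne (m + 1)).restrict (crossPolytope (m + 1)) :=
    map_radialRescaling_withDensity_exp_neg_norm _ (finrank_ellOne (m + 1))
  refine eq_inv_smul_restrict_of_eq_smul_restrict
    (c := ENNReal.ofReal (2⁻¹ ^ (m + 1)) * (m + 1)!) ?_
  rw [expMeasure_eq_smul, Measure.map_smul, hmap, smul_smul]

theorem dist_radialMap_transportProfile_le (x y : EllOne (m + 1)) :
    dist (radialMap (transportProfile m) x) (radialMap (transportProfile m) y) ≤
      2 * exp 1 / (m + 1) * dist x y := by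
  have h : dist (radialMap (transportProfile m) x) (radialMap (transportProfile m) y) ≤
      (2 * (radialLip m).toNNReal : ℝ≥0) * dist x y :=
    (lipschitzWith_radialRescaling (monotone_transportProfile m)
      (lipschitzWith_transportProfile m) (transportProfile_zero m)).dist_le_mul x y
  refine h.trans (mul_le_mul_of_nonneg_right ?_ dist_nonneg)
  rw [NNReal.coe_mul, NNReal.coe_ofNat, Real.coe_toNNReal _ (radialLip_pos m).le, mul_div_assoc]
  exact mul_le_mul_of_nonneg_left (radialLip_le m) zero_le_two

theorem hasLaplaceBound_uniformCrossPolytope {l : ℝ} (hl₀ : 0 ≤ l) (hl₁ : l < 1) :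
    HasLaplaceBound (fun x y => l * (m + 1) / (2 * exp 1) * dist x y)
      (uniformCrossPolytope (m + 1)) ((ENNReal.ofReal (1 - l ^ 2)⁻¹ ^ 2) ^ (m + 1)) := by
  rw [← map_radialMap_transportProfile]
  refine (hasLaplaceBound_expMeasure hl₀ hl₁).map
    (measurable_radialMap_transportProfile m) fun x y => ?_
  calc l * (m + 1) / (2 * exp 1) *
        dist (radialMap (transportProfile m) x) (radialMap (transportProfile m) y)
      ≤ l * (m + 1) / (2 * exp 1) * (2 * exp 1 / (m + 1) * dist x y) := by
        gcongr
        exact dist_radialMap_transportProfile_le m x y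
    _ = l * dist x y := by field_simp

theorem inv_one_sub_sq_le_exp {l : ℝ} (hl : l ^ 2 ≤ 1 / 2) : (1 - l ^ 2)⁻¹ ≤ exp (2 * l ^ 2) := by
  rw [inv_le_iff_one_le_mul₀ (by linarith)]
  nlinarith [Real.add_one_le_exp (2 * l ^ 2), sq_nonneg l]

theorem hasLaplaceBound_uniformCrossPolytope_exp {l : ℝ} (hl₀ : 0 ≤ l) (hl : l ^ 2 ≤ 1 / 2) :
    HasLaplaceBound (fun x y => l * (m + 1) / (2 * exp 1) * dist x y)
      (uniformCrossPolytope (m + 1)) (ENNReal.ofReal (exp (4 * l ^ 2 * (m + 1)))) := by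
  have hl₁ : l < 1 := by nlinarith
  refine fun f hf hfd => (hasLaplaceBound_uniformCrossPolytope m hl₀ hl₁ f hf hfd).trans ?_
  calc (ENNReal.ofReal (1 - l ^ 2)⁻¹ ^ 2) ^ (m + 1)
      ≤ (ENNReal.ofReal (exp (2 * l ^ 2)) ^ 2) ^ (m + 1) := by
        gcongr
        exact inv_one_sub_sq_le_exp hl
    _ = ENNReal.ofReal (exp (4 * l ^ 2 * (m + 1))) := by
        rw [← pow_mul, ← ENNReal.ofReal_pow (by positivity), ← Real.exp_nat_mul]
        push_cast
        ring_nf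

theorem concentrationFunction_uniformCrossPolytope_le {ε : ℝ} (hε : 0 ≤ ε) :
    concentrationFunction (uniformCrossPolytope (m + 1)) ε ≤
      ENNReal.ofReal (2 * exp (-(8 * exp 1)⁻¹ ^ 2 * ε ^ 2 * (m + 1))) := by
  rcases le_or_gt 2 ε with hε₂ | hε₂
  · rw [concentrationFunction_eq_zero_of_dist_le (ae_mem_crossPolytope (m + 1)) fun x hx y hy =>
      (dist_le_two_of_mem_crossPolytope hx hy).trans hε₂]
    exact zero_le
  -- `l` minimizes the exponent `4 * l ^ 2 * (m + 1) - l * (m + 1) / (2 * exp 1) * ε`.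
  set l : ℝ := ε / (16 * exp 1) with hl
  have hl₀ : 0 ≤ l := by positivity
  have hl_le : l ≤ 1 / 8 := by
    rw [hl, div_le_iff₀ (by positivity)]
    linarith [Real.add_one_le_exp 1]
  refine (concentrationFunction_le_of_hasLaplaceBound
    (hasLaplaceBound_uniformCrossPolytope_exp m hl₀ (by nlinarith)) (by positivity) ε).trans_eq ?_
  rw [← ENNReal.ofReal_mul (by positivity), ← Real.exp_add, ENNReal.ofReal_mul zero_le_two,
    ENNReal.ofReal_ofNat]
  congr 3
  rw [hl]
  field_simp
  ring

end CrossPolytope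

theorem mainTheorem6 :
    ∃ a b c K : ℝ, 0 < a ∧ 0 < b ∧ 0 < c ∧ 0 < K ∧ ∀ n : ℕ, 1 ≤ n →
      (∃ u : ℝ≥0 → ℝ≥0, u 0 = 0 ∧ Monotone u ∧
        Measurable (radialMap (n := n) u) ∧
        (expMeasure n).map (radialMap u) = uniformCrossPolytope n ∧
        ∃ L : ℝ≥0, IsLeast {M : ℝ≥0 | LipschitzWith M u} L ∧
          a / (n : ℝ) ≤ (L : ℝ) ∧ (L : ℝ) ≤ b / (n : ℝ)) ∧
      ∀ ε : ℝ, 0 < ε →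
        concentrationFunction (uniformCrossPolytope n) ε
          ≤ ENNReal.ofReal (K * Real.exp (-c * ε ^ 2 * (n : ℝ))) := by
  refine ⟨1, Real.exp 1, (8 * Real.exp 1)⁻¹ ^ 2, 2, one_pos, Real.exp_pos 1, by positivity,
    two_pos, fun n hn => ?_⟩
  obtain ⟨m, rfl⟩ := Nat.exists_eq_add_of_le' hn
  have hL : ((radialLip m).toNNReal : ℝ) = radialLip m := Real.coe_toNNReal _ (radialLip_pos m).le
  rw [Nat.cast_succ]
  refine ⟨⟨transportProfile m, transportProfile_zero m, monotone_transportProfile m,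
    measurable_radialMap_transportProfile m, map_radialMap_transportProfile m,
    (radialLip m).toNNReal,
    ⟨lipschitzWith_transportProfile m, fun M hM => ?_⟩, ?_, ?_⟩,
    fun ε hε => concentrationFunction_uniformCrossPolytope_le m hε.le⟩
  · exact Real.toNNReal_le_iff_le_coe.2 (radialLip_le_of_lipschitzWith m hM)
  · exact (one_div_le_radialLip m).trans_eq hL.symm
  · exact hL.trans_le (radialLip_le m)
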